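/- All homotopies of paths are relative to endpoints. Let $X$ be a connected, locally path connected space and $x\in X$. For an open cover $\mathcal U$ of $X$ let $\pi(\mathcal U,x)\le\pi_1(X,x)$ be the subgroup of all classes of finite products $\prod_{j=1}^n \alpha_j*\beta_j*\alpha_j^{-1}$, where each $\alpha_j$ is a path in $X$ starting at $x$ and each $\beta_j$ is a loop based at $\alpha_j(1)$ whose image lies in some member of $\mathcal U$; the Spanier group of $X$ is $\pi_1^{sp}(X,x)=\bigcap_{\mathcal U}\pi(\mathcal U,x)$, the intersection being over all open covers $\mathcal U$ of $X$. A categorical universal covering of $X$ is a covering map $p:\widetilde X\to X$ with $\widetilde X$ path connected such that for every covering map $q:\widetilde Y\to X$ with $\widetilde Y$ path connected there is a covering map $f:\widetilde X\to\widetilde Y$ with $q\circ f=p$, and $f$ is unique up to equivalence: if $f'$ is another such covering map, then $f'=f\circ h$ for some homeomorphism $h:\widetilde X\to\widetilde X$. (a) If $X$ is first countable and the quotient $\pi_1(X,x)/\pi_1^{sp}(X,x)$ is countable, then $X$ has a categorical universal covering. (b) Conversely, if $X$ is separable and metrizable and has a categorical universal covering, then $\pi_1(X,x)/\pi_1^{sp}(X,x)$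 is countable. -/

import Mathlib

universe u v

/-- The family `𝒰` of subsets of `X` is an open cover of `X`. -/
def IsOpenCovering {X : Type u} [TopologicalSpace X] (𝒰 : Set (Set X)) : Prop :=
  (∀ V ∈ 𝒰, IsOpen V) ∧ ⋃₀ 𝒰 = Set.univ

/-- The Spanier group `π(𝒰, x)` with respect to `𝒰`: the subgroup of `π₁(X, x)` generated by
the classes `[α * β * α⁻¹]`, with `α` a path starting at `x` and `β` a loop at the end point of `α`
that lies inside a member of `𝒰`. (The inverse of such a class is again such a class, so the
elements of this subgroup are the finite products of these classes.) -/
noncomputable def spanierGroupOfCover {X : Type u} [TopologicalSpace X] (𝒰 : Set (Set X)) (x : X) :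
    Subgroup (FundamentalGroup X x) :=
  Subgroup.closure {g | ∃ (y : X) (α : Path x y) (β : Path y y),
    (∃ V ∈ 𝒰, Set.range β ⊆ V) ∧
      g = FundamentalGroup.fromPath
        (Path.Homotopic.Quotient.mk ((α.trans β).trans α.symm))}

/-- The Spanier group `π₁^sp(X, x)`: the intersection of the groups `π(𝒰, x)` over all open
covers `𝒰` of `X`. -/
noncomputable def spanierGroup (X : Type u) [TopologicalSpace X] (x : X) : Subgroup (FundamentalGroup X x) :=
  ⨅ (𝒰 : Set (Set X)) (_ : IsOpenCovering 𝒰), spanierGroupOfCover 𝒰 x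

/-- `p : E → X` is a categorical universal covering: a path connected covering such that for every
path connected covering `q : Y → X` there is a covering `f : E → Y` with `q ∘ f = p`, and any two
such `f` are equivalent as coverings of `Y`.

`IsCoveringMap` does not include surjectivity, but a covering map from a nonempty space to a
connected space is surjective, so for connected `X` all of `p`, `q` and `f` are surjective here.
The universe `v` is that of the test spaces `Y`. -/
def IsCategoricalUniversalCovering {X E : Type u} [TopologicalSpace X] [TopologicalSpace E]
    (p : E → X) : Prop :=
  PathConnectedSpace E ∧ IsCoveringMap p ∧
    ∀ (Y : Type v) [TopologicalSpace Y] [PathConnectedSpace Y] (q : Y → X), IsCoveringMap q →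
      (∃ f : E → Y, IsCoveringMap f ∧ q ∘ f = p) ∧
      ∀ f f' : E → Y, IsCoveringMap f → IsCoveringMap f' → q ∘ f = p → q ∘ f' = p →
        ∃ h : E ≃ₜ E, f ∘ h = f'

/-- `X` has a categorical universal covering, universal among the path connected coverings by
spaces in `Type v`. -/
def HasCategoricalUniversalCovering (X : Type u) [TopologicalSpace X] : Prop :=
  ∃ (E : Type u) (_ : TopologicalSpace E) (p : E → X),
    IsCategoricalUniversalCovering.{u, v} p

/-! Part (a) reduces to finding one cover `𝒰` with π(𝒰, x) inside the Spanier group. If a normal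
subgroup N contains some π(𝒰, x), the principal bundle with discrete fibre π₁/N is a covering on
which loops act by their class mod N (`exists_isCoveringMap_of_spanierGroupOfCover_le`). On the
other hand, any covering is trivial over the members of some cover, so the Spanier group acts
trivially on its fibres. Hence, by the lifting criterion, a path connected covering with stabilizers
inside the Spanier group maps to every other one.

If no such `𝒰` existed, some point would have arbitrarily small loops outside the Spanier group.
Choose a shrinking sequence of them, each missed by some π(𝒱, x) that contains all later ones.
Concatenating the loops indexed by a subset of ℕ then gives a different coset for each subset,
contradicting countability (`Holonomy.exists_nhds_hol_mem`).

For (b), a universal covering factors through the covering attached to each π(𝒰, x), so its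
stabilizers lie in the Spanier group. Cosets therefore inject into an orbit in a fibre, which is
countable because the endpoint of a lift depends continuously on the loop, the loop space is second
countable and the fibre is discrete. -/

open Set Topology

/-! ### Holonomy and the associated principal bundle -/

/-- A homomorphism from the fundamental groupoid of `X` to a group `Q`, given on paths. As in
`FundamentalGroup`, concatenation of paths corresponds to the reversed product. -/
structure Holonomy (X : Type*) [TopologicalSpace X] (Q : Type*) [Group Q] where
  /-- The value on a path. -/
  hol : ∀ {y z : X}, Path y z → Q
  hol_trans : ∀ {y z w : X} (a : Path y z) (b : Path z w), hol (a.trans b) = hol b * hol a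
  hol_congr : ∀ {y z : X} {a b : Path y z}, a.Homotopic b → hol a = hol b

namespace Holonomy

variable {X : Type*} [TopologicalSpace X] {Q : Type*} [Group Q] (h : Holonomy X Q)

@[simp]
theorem hol_refl (y : X) : h.hol (Path.refl y) = 1 := by
  have := h.hol_trans (Path.refl y) (Path.refl y)
  rwa [Path.refl_trans_refl, left_eq_mul] at this

@[simp]
theorem hol_symm {y z : X} (a : Path y z) : h.hol a.symm = (h.hol a)⁻¹ := by
  rw [eq_inv_iff_mul_eq_one, ← h.hol_trans, ← h.hol_refl y]
  exact h.hol_congr ⟨(Path.Homotopy.reflTransSymm a).symm⟩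

@[simp]
theorem hol_cast {y z y' z' : X} (a : Path y z) (hy : y' = y) (hz : z' = z) :
    h.hol (a.cast hy hz) = h.hol a := by
  subst hy hz; rfl

theorem hol_conj_mem_iff (S : Subgroup Q) [S.Normal] {y z : X} (α : Path y z) (β : Path z z) :
    h.hol ((α.trans β).trans α.symm) ∈ S ↔ h.hol β ∈ S := by
  rw [h.hol_trans, h.hol_trans, h.hol_symm]
  exact (Subgroup.Normal.mem_comm_iff ‹_›).trans (by rw [mul_inv_cancel_right])

/-- The holonomy is trivial on all loops in the set `V`. -/
def TrivialOn (V : Set X) : Prop :=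
  ∀ ⦃z : X⦄ (β : Path z z), range β ⊆ V → h.hol β = 1

variable {h} in
theorem TrivialOn.mono {V W : Set X} (hV : h.TrivialOn V) (hWV : W ⊆ V) : h.TrivialOn W :=
  fun _ β hβ ↦ hV β (hβ.trans hWV)

variable {h} in
theorem TrivialOn.hol_eq {V : Set X} (hV : h.TrivialOn V) {y z : X} {a b : Path y z}
    (ha : range a ⊆ V) (hb : range b ⊆ V) : h.hol a = h.hol b := by
  have := hV (a.trans b.symm) (by rw [Path.trans_range, Path.symm_range]; exact union_subset ha hb)
  rw [h.hol_trans, h.hol_symm] at this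
  exact (inv_mul_eq_one.mp this).symm

theorem hol_subpath_mul {y z : X} (γ : Path y z) (r s t : unitInterval) :
    h.hol (γ.subpath s t) * h.hol (γ.subpath r s) = h.hol (γ.subpath r t) := by
  rw [← h.hol_trans]
  exact h.hol_congr ⟨Path.Homotopy.subpathTransSubpath γ r s t⟩

/-- `V` is a path connected open neighborhood of `y` with trivial holonomy. -/
structure IsSimpleAt (y : X) (V : Set X) : Prop where
  isOpen : IsOpen V
  mem : y ∈ V
  isPathConnected : IsPathConnected V
  trivialOn : h.TrivialOn V

open Classical in
/-- The holonomy along any path in `V` from `y` to `z`. -/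
noncomputable def transport (V : Set X) (y z : X) : Q :=
  -- The default 1 is arbitrary: the cocycle identities in `core` hold for any values, and
  -- continuity is needed only on overlaps, where the paths exist.
  if hz : JoinedIn V y z then h.hol hz.somePath else 1

variable {h} in
theorem TrivialOn.transport_eq {V : Set X} (hV : h.TrivialOn V) {y z : X}
    (a : Path y z) (ha : range a ⊆ V) : h.transport V y z = h.hol a := by
  have hz : JoinedIn V y z := ⟨a, fun t ↦ ha ⟨t, rfl⟩⟩
  rw [transport, dif_pos hz]
  exact hV.hol_eq (by rintro _ ⟨t, rfl⟩; exact hz.somePath_mem t) ha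

variable {h} in
theorem IsSimpleAt.transport_mul {V : Set X} {y : X} (hV : h.IsSimpleAt y V) {z w : X}
    (hz : z ∈ V) (a : Path z w) (ha : range a ⊆ V) :
    h.transport V y w = h.hol a * h.transport V y z := by
  obtain ⟨b, hb⟩ := hV.isPathConnected.joinedIn y hV.mem z hz
  have hb' : range b ⊆ V := by rintro _ ⟨t, rfl⟩; exact hb t
  rw [hV.trivialOn.transport_eq b hb', ← h.hol_trans]
  exact hV.trivialOn.transport_eq _ (by rw [Path.trans_range]; exact union_subset hb' ha)

theorem transport_self {V : Set X} {y : X} (hV : h.IsSimpleAt y V) : h.transport V y y = 1 := by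
  rw [hV.trivialOn.transport_eq (Path.refl y) (by simpa using hV.mem), h.hol_refl]

variable [TopologicalSpace Q] [DiscreteTopology Q] [LocallyPathConnectedSpace X]

/-- The principal bundle with discrete structure group `Q` and holonomy `h`. -/
noncomputable def core {V : X → Set X} (hV : ∀ y, h.IsSimpleAt y (V y)) :
    FiberBundleCore X X Q where
  baseSet := V
  isOpen_baseSet y := (hV y).isOpen
  indexAt := id
  mem_baseSet_at y := (hV y).mem
  coordChange i j z g := (h.transport (V j) j z)⁻¹ * h.transport (V i) i z * g
  coordChange_self _ _ _ _ := by simp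
  coordChange_comp _ _ _ _ _ _ := by group
  continuousOn_coordChange i j := by
    refine continuousOn_of_forall_continuousAt ?_
    rintro ⟨z, g⟩ ⟨⟨hi, hj⟩, -⟩
    obtain ⟨W, ⟨hWz, hW⟩, hWV⟩ := (path_connected_basis z).mem_iff.mp
      (((hV i).isOpen.inter (hV j).isOpen).mem_nhds ⟨hi, hj⟩)
    have hc : ContinuousAt
        (fun p : X × Q ↦ (h.transport (V j) j z)⁻¹ * h.transport (V i) i z * p.2) (z, g) := by
      fun_prop
    refine hc.congr ?_
    filter_upwards [continuousAt_fst.preimage_mem_nhds hWz] with ⟨w, g'⟩ (hw : w ∈ W)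
    obtain ⟨a, ha⟩ := hW.joinedIn z (mem_of_mem_nhds hWz) w hw
    have ha' : range a ⊆ V i ∩ V j := by rintro _ ⟨t, rfl⟩; exact hWV (ha t)
    simp only
    -- Moving from `z` to `w` multiplies both transports on the left by `h.hol a`, which cancels:
    -- the transition function is locally constant.
    rw [(hV i).transport_mul hi a (ha'.trans inter_subset_left),
      (hV j).transport_mul hj a (ha'.trans inter_subset_right)]
    group

variable {V : X → Set X} (hV : ∀ y, h.IsSimpleAt y (V y))

theorem isCoveringMap_core : IsCoveringMap (h.core hV).proj :=
  FiberBundle.isCoveringMap (F := Q) (E := (h.core hV).Fiber)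

/-- In the chart at `γ s` the curve has constant second coordinate near `s`, since short subpaths
realize the transport. -/
theorem continuous_lift_core {y z : X} (γ : Path y z) (g : Q) :
    Continuous fun s : unitInterval ↦ (⟨γ s, h.hol (γ.subpath 0 s) * g⟩ : (h.core hV).TotalSpace) := by
  refine continuous_iff_continuousAt.mpr fun s ↦ ?_
  have hγ : γ ⁻¹' V (γ s) ∈ 𝓝 s :=
    γ.continuous.continuousAt.preimage_mem_nhds ((hV _).isOpen.mem_nhds (hV _).mem)
  refine (((h.core hV).localTrivAt (γ s)).toOpenPartialHomeomorph
    |>.continuousAt_iff_continuousAt_comp_left ?_).2 ?_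
  · exact hγ
  · have hc : ContinuousAt (fun r : unitInterval ↦ (γ r, h.hol (γ.subpath 0 s) * g)) s := by fun_prop
    refine hc.congr ?_
    filter_upwards [ordConnectedComponent_mem_nhds.mpr hγ] with r hr
    have hr' : range (γ.subpath s r) ⊆ V (γ s) := by
      rw [γ.range_subpath, image_subset_iff]; exact hr
    have ht : h.transport (V (γ r)) (γ r) (γ r) = 1 := h.transport_self (hV _)
    have ht' := (hV (γ s)).trivialOn.transport_eq _ hr'
    refine Prod.ext rfl ?_
    change _ = (h.transport (V (γ s)) (γ s) (γ r))⁻¹ * h.transport (V (γ r)) (γ r) (γ r) *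
      (h.hol (γ.subpath 0 r) * g)
    rw [ht, ht', ← h.hol_subpath_mul γ 0 s r]
    group

theorem monodromy_core {y z : X} (γ : Path y z) (g : Q) :
    ((h.isCoveringMap_core hV).monodromy (.mk γ) ⟨⟨y, g⟩, rfl⟩).1 = ⟨z, h.hol γ * g⟩ := by
  have key : ∀ {w w' : X} {q q' : Q}, w = w' → q = q' →
      (⟨w, q⟩ : (h.core hV).TotalSpace) = ⟨w', q'⟩ := by rintro _ _ _ _ rfl rfl; rfl
  have hlift := ((h.isCoveringMap_core hV).eq_liftPath_iff' (γ := γ) (e := ⟨y, g⟩) γ.source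
    (Γ := ⟨_, h.continuous_lift_core hV γ g⟩)).mpr
    ⟨rfl, key γ.source (by simp [Path.subpath_self])⟩
  refine (congr($hlift 1).symm.trans (key γ.target ?_))
  rw [γ.subpath_zero_one, h.hol_cast]

theorem pathConnectedSpace_core [Nonempty X]
    (hsurj : ∀ (y z : X) (q : Q), ∃ γ : Path y z, h.hol γ = q) :
    PathConnectedSpace (h.core hV).TotalSpace where
  nonempty := ⟨⟨Classical.arbitrary X, (1 : Q)⟩⟩
  joined := by
    rintro ⟨y, (g : Q)⟩ ⟨z, (g' : Q)⟩
    obtain ⟨γ, hγ⟩ := hsurj y z (g' * g⁻¹)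
    have hm := h.monodromy_core hV γ g
    rw [hγ, inv_mul_cancel_right] at hm
    rw [← hm]
    exact ⟨⟨(h.isCoveringMap_core hV).liftPath γ ⟨y, g⟩ γ.source,
      (h.isCoveringMap_core hV).liftPath_zero .., rfl⟩⟩

end Holonomy

/-! ### Holonomy in the fundamental group and its quotients -/

section Quotient

variable {X : Type*} [TopologicalSpace X]

open Path.Homotopic.Quotient PathConnectedSpace

theorem Path.Homotopic.Quotient.symm_trans_cancel {a b c : X} (p : Path.Homotopic.Quotient a b)
    (q : Path.Homotopic.Quotient b c) : p.symm.trans (p.trans q) = q := by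
  rw [← Path.Homotopic.Quotient.trans_assoc, Path.Homotopic.Quotient.symm_trans,
    Path.Homotopic.Quotient.refl_trans]

theorem Path.Homotopic.Quotient.trans_symm_cancel {a b c : X} (p : Path.Homotopic.Quotient a b)
    (q : Path.Homotopic.Quotient a c) : p.trans (p.symm.trans q) = q := by
  rw [← Path.Homotopic.Quotient.trans_assoc, Path.Homotopic.Quotient.trans_symm,
    Path.Homotopic.Quotient.refl_trans]

variable [PathConnectedSpace X] {x : X}

variable (x) in
/-- The holonomy with values in the fundamental group, after a choice of a path from `x` to every
point. -/
noncomputable def pathHolonomy : Holonomy X (FundamentalGroup X x) where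
  hol {y z} δ := FundamentalGroup.fromPath
    (((mk (somePath x y)).trans (mk δ)).trans (mk (somePath x z)).symm)
  hol_trans {y z w} a b := by
    rw [FundamentalGroup.mul_def]
    simp [Path.Homotopic.Quotient.trans_assoc, Path.Homotopic.Quotient.symm_trans_cancel]
  hol_congr {y z a b} hab := by rw [Path.Homotopic.Quotient.eq.mpr hab]

/-- The holonomy with values in the quotient of the fundamental group by a normal subgroup. -/
noncomputable def quotientHolonomy (N : Subgroup (FundamentalGroup X x)) [N.Normal] :
    Holonomy X (FundamentalGroup X x ⧸ N) where
  hol δ := QuotientGroup.mk ((pathHolonomy x).hol δ)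
  hol_trans a b := by rw [(pathHolonomy x).hol_trans, QuotientGroup.mk_mul]
  hol_congr hab := by rw [(pathHolonomy x).hol_congr hab]

variable (N : Subgroup (FundamentalGroup X x)) [N.Normal]

theorem quotientHolonomy_surjective (y z : X) (q : FundamentalGroup X x ⧸ N) :
    ∃ γ : Path y z, (quotientHolonomy N).hol γ = q := by
  obtain ⟨a, rfl⟩ := QuotientGroup.mk_surjective q
  obtain ⟨a, rfl⟩ := Path.Homotopic.Quotient.mk_surjective a
  refine ⟨((somePath x y).symm.trans a).trans (somePath x z), ?_⟩
  simp only [quotientHolonomy, pathHolonomy, mk_trans, mk_symm]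
  simp [Path.Homotopic.Quotient.trans_assoc, Path.Homotopic.Quotient.trans_symm_cancel]

/-- The chosen path from `x` to `x` need not be constant, so the two elements are only conjugate;
normality absorbs this. -/
theorem pathHolonomy_mem_iff (β : Path x x) :
    (pathHolonomy x).hol β ∈ N ↔ FundamentalGroup.fromPath (mk β) ∈ N := by
  have : (pathHolonomy x).hol β =
    (FundamentalGroup.fromPath (mk (somePath x x)))⁻¹ * FundamentalGroup.fromPath (mk β) *
      FundamentalGroup.fromPath (mk (somePath x x)) := by
    simp only [pathHolonomy, FundamentalGroup.mul_def, FundamentalGroup.inv_def,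
      Path.Homotopic.Quotient.trans_assoc]
  rw [this]
  exact (Subgroup.Normal.mem_comm_iff ‹_›).trans (by rw [mul_inv_cancel_left])

theorem pathHolonomy_loop_mem_iff {y : X} (α : Path x y) (β : Path y y) :
    (pathHolonomy x).hol β ∈ N ↔
      FundamentalGroup.fromPath (mk ((α.trans β).trans α.symm)) ∈ N := by
  rw [← pathHolonomy_mem_iff, Holonomy.hol_conj_mem_iff]

end Quotient

/-! ### Spanier groups and coverings -/

section Spanier

variable {X : Type u} [TopologicalSpace X]

/-- Conjugating a generator only prolongs its path `α` by a loop. -/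
instance spanierGroupOfCover_normal (𝒰 : Set (Set X)) (x : X) :
    (spanierGroupOfCover 𝒰 x).Normal := by
  rw [← Subgroup.normalizer_eq_top_iff, eq_top_iff, spanierGroupOfCover,
    Subgroup.le_normalizer_closure_iff]
  rintro g - _ ⟨y, α, β, hβ, rfl⟩
  obtain ⟨η, rfl⟩ := Path.Homotopic.Quotient.mk_surjective g
  refine Subgroup.subset_closure ⟨y, η.symm.trans α, β, hβ, ?_⟩
  rw [FundamentalGroup.mul_def, FundamentalGroup.mul_def, FundamentalGroup.inv_def]
  simp [Path.trans_symm, Path.Homotopic.Quotient.trans_assoc]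

instance spanierGroup_normal (x : X) : (spanierGroup X x).Normal :=
  Subgroup.normal_iInf_normal fun 𝒰 ↦ Subgroup.normal_iInf_normal fun _ ↦
    spanierGroupOfCover_normal 𝒰 x

theorem spanierGroup_le {𝒰 : Set (Set X)} (h𝒰 : IsOpenCovering 𝒰) (x : X) :
    spanierGroup X x ≤ spanierGroupOfCover 𝒰 x :=
  iInf₂_le 𝒰 h𝒰

theorem quotientHolonomy_trivialOn_of_mem [PathConnectedSpace X] {x : X} {𝒰 : Set (Set X)}
    {N : Subgroup (FundamentalGroup X x)} [N.Normal] (hN : spanierGroupOfCover 𝒰 x ≤ N)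
    {V : Set X} (hV : V ∈ 𝒰) : (quotientHolonomy N).TrivialOn V := fun z β hβ ↦ by
  refine (QuotientGroup.eq_one_iff _).mpr ?_
  rw [pathHolonomy_loop_mem_iff N (PathConnectedSpace.somePath x z)]
  exact hN (Subgroup.subset_closure ⟨z, _, β, ⟨V, hV, hβ⟩, rfl⟩)

theorem exists_isCoveringMap_of_spanierGroupOfCover_le [PathConnectedSpace X]
    [LocallyPathConnectedSpace X] {x : X} {𝒰 : Set (Set X)} (h𝒰 : IsOpenCovering 𝒰)
    {N : Subgroup (FundamentalGroup X x)} [N.Normal] (hN : spanierGroupOfCover 𝒰 x ≤ N) :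
    ∃ (E : Type u) (_ : TopologicalSpace E) (p : E → X) (cov : IsCoveringMap p),
      PathConnectedSpace E ∧
      ∀ (e : p ⁻¹' {x}) (γ : FundamentalGroup X x), cov.monodromy γ e = e ↔ γ ∈ N := by
  have hsimple : ∀ y : X, ∃ V, (quotientHolonomy N).IsSimpleAt y V := fun y ↦ by
    obtain ⟨U, hU, hy⟩ := mem_sUnion.mp (h𝒰.2 ▸ mem_univ y)
    obtain ⟨V, ⟨hVo, hyV, hVc⟩, hVU⟩ :=
      (isOpen_isPathConnected_basis y).mem_iff.mp ((h𝒰.1 U hU).mem_nhds hy)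
    exact ⟨V, hVo, hyV, hVc, (quotientHolonomy_trivialOn_of_mem hN hU).mono hVU⟩
  choose V hV using hsimple
  let _ : TopologicalSpace (FundamentalGroup X x ⧸ N) := ⊥
  have : DiscreteTopology (FundamentalGroup X x ⧸ N) := ⟨rfl⟩
  refine ⟨_, _, _, (quotientHolonomy N).isCoveringMap_core hV,
    (quotientHolonomy N).pathConnectedSpace_core hV (quotientHolonomy_surjective N), ?_⟩
  rintro ⟨⟨y, (g : FundamentalGroup X x ⧸ N)⟩, hy⟩ γ
  obtain rfl : y = x := hy
  obtain ⟨γ, rfl⟩ := Path.Homotopic.Quotient.mk_surjective γ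
  rw [Subtype.ext_iff, (quotientHolonomy N).monodromy_core hV γ g]
  refine Iff.trans ?_ ((QuotientGroup.eq_one_iff _).trans (pathHolonomy_mem_iff N γ))
  change _ ↔ (quotientHolonomy N).hol γ = 1
  constructor
  · intro heq
    have : (quotientHolonomy N).hol γ * g = g := eq_of_heq (Bundle.TotalSpace.mk.inj heq).2
    simpa using this
  · intro h1
    have : (quotientHolonomy N).hol γ * g = g := by rw [h1, one_mul]
    exact congrArg (Bundle.TotalSpace.mk _) this

/-- A loop in an evenly covered set lifts within one sheet, hence to a loop; conjugating by `α`
preserves trivial monodromy. -/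
theorem IsCoveringMap.exists_isOpenCovering_le_ker_monodromyPerm {Y : Type v} [TopologicalSpace Y]
    {q : Y → X} (cov : IsCoveringMap q) :
    ∃ 𝒰, IsOpenCovering 𝒰 ∧ ∀ x, spanierGroupOfCover 𝒰 x ≤ (cov.monodromyPerm x).ker := by
  refine ⟨{U | IsOpen U ∧ ∃ (I : Type v) (_ : TopologicalSpace I) (_ : DiscreteTopology I)
    (H : q ⁻¹' U ≃ₜ U × I), ∀ e, (H e).1.1 = q e}, ⟨fun _ h ↦ h.1, ?_⟩, ?_⟩
  · refine eq_univ_of_forall fun y ↦ ?_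
    obtain ⟨hd, U, hy, hU, -, H, hH⟩ := cov y
    exact ⟨U, ⟨hU, _, _, hd, H, hH⟩, hy⟩
  intro x
  refine (Subgroup.closure_le _).mpr ?_
  rintro _ ⟨y, α, β, ⟨U, ⟨hU, I, _, _, H, hH⟩, hβ⟩, rfl⟩
  have hloop : ∀ e, cov.monodromy (.mk β) e = e := by
    rintro ⟨e, rfl⟩
    have hmem : ∀ t, β t ∈ U := fun t ↦ hβ ⟨t, rfl⟩
    have he : q e ∈ U := by simpa using hmem 0
    let Γ : C(unitInterval, Y) := ⟨fun t ↦ (H.symm (⟨β t, hmem t⟩, (H ⟨e, he⟩).2)).1, by fun_prop⟩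
    have hΓ : ∀ t, β t = q e → Γ t = e := fun t ht ↦ by
      have : (⟨⟨β t, hmem t⟩, (H ⟨e, he⟩).2⟩ : U × I) = H ⟨e, he⟩ :=
        Prod.ext (Subtype.ext (by rw [hH]; exact ht)) rfl
      simp only [Γ, ContinuousMap.coe_mk, this, Homeomorph.symm_apply_apply]
    have hl := (cov.eq_liftPath_iff' (γ := β) (e := e) β.source (Γ := Γ)).mpr
      ⟨by ext t; simp [Γ, ← hH], hΓ 0 β.source⟩
    exact Subtype.ext (congr($hl 1).symm.trans (hΓ 1 β.target))
  refine MonoidHom.mem_ker.mpr (Equiv.ext fun e ↦ ?_)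
  change cov.monodromy (((Path.Homotopic.Quotient.mk α).trans (.mk β)).trans
    (Path.Homotopic.Quotient.mk α).symm) e = e
  rw [cov.monodromy_trans_apply, cov.monodromy_trans_apply, hloop, ← cov.monodromy_trans_apply,
    Path.Homotopic.Quotient.trans_symm, cov.monodromy_refl, id]

end Spanier

/-! ### Maps between coverings -/

section Coverings

variable {X : Type*} [TopologicalSpace X] {E : Type*} [TopologicalSpace E] {Y : Type*}
  [TopologicalSpace Y]

theorem IsCoveringMap.surjective_of_nonempty [PathConnectedSpace X] [Nonempty E] {p : E → X}
    (cov : IsCoveringMap p) : Function.Surjective p := fun y ↦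
  ⟨_, (cov.monodromy (.mk (PathConnectedSpace.somePath (p (Classical.arbitrary E)) y))
    ⟨_, rfl⟩).2⟩

theorem IsLocalHomeomorph.locallyPathConnectedSpace [LocallyPathConnectedSpace X] {p : E → X}
    (hp : IsLocalHomeomorph p) : LocallyPathConnectedSpace E := by
  choose φ hφ _ using hp
  let _ : ChartedSpace X E :=
    { atlas := range φ
      chartAt := φ
      mem_chart_source := hφ
      chart_mem_atlas := fun e ↦ ⟨e, rfl⟩ }
  exact ChartedSpace.locallyPathConnectedSpace X E

/-- A continuous map between two coverings of a locally path connected space is a covering. -/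
theorem IsCoveringMap.of_comp [LocallyPathConnectedSpace X] {p : E → X} {q : Y → X} {f : E → Y}
    (hp : IsCoveringMap p) (hq : IsCoveringMap q) (hf : Continuous f) (hqf : q ∘ f = p) :
    IsCoveringMap f := by
  intro y
  obtain ⟨hdp, U, hyU, hU, -, H, hH⟩ := hp (q y)
  obtain ⟨hdq, W, hyW, hW, -, K, hK⟩ := hq (q y)
  obtain ⟨V, ⟨hVo, hyV, hVc⟩, hVUW⟩ := (isOpen_isPathConnected_basis (q y)).mem_iff.mp
    ((hU.inter hW).mem_nhds ⟨hyU, hyW⟩)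
  have hVU : V ⊆ U := hVUW.trans inter_subset_left
  have hVW : V ⊆ W := hVUW.trans inter_subset_right
  have hqf' : ∀ e, q (f e) = p e := fun e ↦ congrFun hqf e
  have := isPathConnected_iff_pathConnectedSpace.mp hVc
  let b := (K ⟨y, hyW⟩).2
  -- the sheet of `q` over `V` through `y`
  let S : Set Y := {z | ∃ hz : q z ∈ V, (K ⟨z, hVW hz⟩).2 = b}
  -- the section of `p` over `V` with label `a`
  let σ (a : p ⁻¹' {q y}) (v : V) : E := (H.symm (⟨v, hVU v.2⟩, a)).1
  have hpσ : ∀ a v, p (σ a v) = v := fun a v ↦ by simp [σ, ← hH]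
  have hσ : ∀ a, Continuous (σ a) := fun a ↦ by fun_prop
  -- the sheet of `q` in which the image of the section lies
  have hlabel : ∀ a (v w : V) h h', (K ⟨f (σ a v), h⟩).2 = (K ⟨f (σ a w), h'⟩).2 := by
    intro a v w h h'
    have hmem : ∀ v, q (f (σ a v)) ∈ W := fun v ↦ by rw [hqf', hpσ]; exact hVW v.2
    have hc : Continuous fun v ↦ (K ⟨f (σ a v), hmem v⟩).2 := by
      have := hσ a; fun_prop
    exact PreconnectedSpace.constant inferInstance hc
  -- As `V` is connected, `f` sends each sheet of `p` over `V` into one sheet of `q`; `A` labels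
  -- those sent into `S`, and they make up `f ⁻¹' S`.
  let A := {a : p ⁻¹' {q y} | f (σ a ⟨q y, hyV⟩) ∈ S}
  have hSo : IsOpen S := by
    have h1 : IsOpen (q ⁻¹' W) := hW.preimage hq.continuous
    have h2 : S = Subtype.val '' {z : q ⁻¹' W | q z ∈ V ∧ (K z).2 = b} := by
      ext z; constructor
      · rintro ⟨hz, hzb⟩; exact ⟨⟨z, hVW hz⟩, ⟨hz, hzb⟩, rfl⟩
      · rintro ⟨z, ⟨hz, hzb⟩, rfl⟩; exact ⟨hz, hzb⟩
    rw [h2]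
    refine h1.isOpenMap_subtype_val _ (IsOpen.inter ?_ ?_)
    · exact hVo.preimage (hq.continuous.comp continuous_subtype_val)
    · exact (isOpen_discrete {b}).preimage (continuous_snd.comp K.continuous)
  have hinj : ∀ z ∈ S, ∀ w ∈ S, q z = q w → z = w := by
    rintro z ⟨hz, hzb⟩ w ⟨hw, hwb⟩ hzw
    have : K ⟨z, hVW hz⟩ = K ⟨w, hVW hw⟩ :=
      Prod.ext (Subtype.ext (by rw [hK, hK]; exact hzw)) (hzb.trans hwb.symm)
    exact congrArg Subtype.val (K.injective this)
  have hA : ∀ a ∈ A, ∀ v, f (σ a v) ∈ S := fun a ha v ↦ by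
    have hv : q (f (σ a v)) ∈ V := by rw [hqf', hpσ]; exact v.2
    obtain ⟨h1, h2⟩ := ha
    exact ⟨hv, (hlabel a v _ _ _).trans h2⟩
  have hσH : ∀ (e : E) (he : p e ∈ V), σ (H ⟨e, hVU he⟩).2 ⟨p e, he⟩ = e := fun e he ↦ by
    have : ((⟨p e, hVU he⟩, (H ⟨e, hVU he⟩).2) : U × p ⁻¹' {q y}) = H ⟨e, hVU he⟩ :=
      Prod.ext (Subtype.ext (by rw [hH])) rfl
    simp only [σ, this, Homeomorph.symm_apply_apply]
  have hpV : ∀ e : f ⁻¹' S, p e ∈ V := fun e ↦ by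
    obtain ⟨h1, -⟩ := e.2
    rwa [hqf'] at h1
  have hmemA : ∀ e : f ⁻¹' S, (H ⟨e, hVU (hpV e)⟩).2 ∈ A := fun e ↦ by
    have hv : q (f (σ (H ⟨e, hVU (hpV e)⟩).2 ⟨q y, hyV⟩)) ∈ V := by rw [hqf', hpσ]; exact hyV
    obtain ⟨h1, h2⟩ := e.2
    refine ⟨hv, (hlabel _ _ ⟨p e, hpV e⟩ _ ?_).trans ?_⟩
    · rw [hσH]; exact hVW h1
    · simp only [hσH]; exact h2
  have hqV : ∀ s : S, q s ∈ V := fun s ↦ s.2.1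
  refine IsEvenlyCovered.to_isEvenlyCovered_preimage (I := A)
    ⟨inferInstance, S, ⟨hyV, rfl⟩, hSo, hSo.preimage hf,
    { toFun := fun e ↦ (⟨f e, e.2⟩, ⟨(H ⟨e, hVU (hpV e)⟩).2, hmemA e⟩)
      invFun := fun s ↦ ⟨σ s.2.1 ⟨q s.1, hqV s.1⟩, hA _ s.2.2 _⟩
      left_inv := fun e ↦ Subtype.ext (by simp only [hqf', hσH])
      right_inv := fun s ↦ by
        refine Prod.ext (Subtype.ext (hinj _ (hA _ s.2.2 _) _ s.1.2 ?_)) (Subtype.ext ?_)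
        · simp only [hqf', hpσ]
        · simp [σ]
      continuous_toFun := by fun_prop
      continuous_invFun := by
        have := hq.continuous
        fun_prop }, fun _ ↦ rfl⟩

end Coverings

/-! ### Monodromy and countable orbits -/

section Monodromy

variable {X : Type*} [TopologicalSpace X] {E : Type*} [TopologicalSpace E] {Y : Type*}
  [TopologicalSpace Y]

theorem IsCoveringMap.monodromy_comp {p : E → X} {q : Y → X} {f : E → Y} (hp : IsCoveringMap p)
    (hq : IsCoveringMap q) (hf : Continuous f) (hqf : ∀ e, q (f e) = p e) {x y : X}
    (γ : Path.Homotopic.Quotient x y) (e : p ⁻¹' {x}) :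
    (hq.monodromy γ ⟨f e, (hqf e).trans e.2⟩).1 = f (hp.monodromy γ e).1 := by
  obtain ⟨γ, rfl⟩ := Path.Homotopic.Quotient.mk_surjective γ
  have he : γ 0 = p e := γ.source.trans e.2.symm
  have hl := (hq.eq_liftPath_iff' (γ := γ) (e := f e) (he.trans (hqf e).symm)
    (Γ := ⟨f ∘ hp.liftPath γ e he, hf.comp (hp.liftPath γ e he).continuous⟩)).mpr
    ⟨by ext t; simpa [hqf] using congrFun (hp.liftPath_lifts γ e he) t,
      congrArg f (hp.liftPath_zero γ e he)⟩
  exact congr($hl 1).symm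

/-- Homotopy lifting with the path space itself as parameter space lifts all paths at once. -/
theorem IsCoveringMap.continuous_monodromy {p : E → X} (hp : IsCoveringMap p) {x y : X}
    (e : p ⁻¹' {x}) : Continuous fun γ : Path x y ↦ hp.monodromy (.mk γ) e := by
  refine Continuous.subtype_mk (f := fun γ : Path x y ↦ (hp.monodromy (.mk γ) e).1) ?_ _
  exact (hp.liftHomotopy (A := Path x y) ⟨fun ta ↦ ta.2 ta.1, by fun_prop⟩ (.const _ e.1)
    (fun γ ↦ γ.source.trans e.2.symm)).continuous.comp (.prodMk_right 1)

theorem Continuous.countable_range_of_discrete [TopologicalSpace.SeparableSpace X]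
    [DiscreteTopology Y] {f : X → Y} (hf : Continuous f) : (range f).Countable := by
  obtain ⟨D, hD, hDd⟩ := TopologicalSpace.exists_countable_dense X
  refine (hD.image f).mono ?_
  rintro _ ⟨a, rfl⟩
  obtain ⟨b, hb, hbD⟩ := hDd.exists_mem_open ((isOpen_discrete {f a}).preimage hf) ⟨a, rfl⟩
  exact ⟨b, hb, hbD⟩

theorem IsCoveringMap.countable_quotient [SecondCountableTopology X] {p : E → X}
    (hp : IsCoveringMap p) {x : X} (e : p ⁻¹' {x}) {N : Subgroup (FundamentalGroup X x)}
    (hN : ∀ γ : FundamentalGroup X x, hp.monodromy γ e = e → γ ∈ N) :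
    Countable (FundamentalGroup X x ⧸ N) := by
  have : SecondCountableTopology (Path x x) :=
    TopologicalSpace.secondCountableTopology_induced _ _ _
  have := (hp x).discreteTopology_fiber
  have hc : (range fun g : FundamentalGroup X x ↦ hp.monodromy g e).Countable := by
    refine (hp.continuous_monodromy (y := x) e).countable_range_of_discrete.mono ?_
    rintro _ ⟨g, rfl⟩
    obtain ⟨γ, rfl⟩ := Path.Homotopic.Quotient.mk_surjective g
    exact ⟨γ, rfl⟩
  have := hc.to_subtype
  refine Function.Injective.countable (β := range fun g : FundamentalGroup X x ↦ hp.monodromy g e)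
    (f := fun a : FundamentalGroup X x ⧸ N ↦ ⟨_, a.out, rfl⟩) fun a b hab ↦ ?_
  have hab' : hp.monodromyPerm x a.out e = hp.monodromyPerm x b.out e := congrArg Subtype.val hab
  rw [← QuotientGroup.out_eq' a, ← QuotientGroup.out_eq' b, QuotientGroup.eq]
  refine hN _ ?_
  change hp.monodromyPerm x ((a.out)⁻¹ * b.out) e = e
  rw [map_mul, map_inv, Equiv.Perm.mul_apply, ← hab']
  exact Equiv.symm_apply_apply _ _

end Monodromy

/-! ### A universal covering forces a countable quotient -/

section Converse

variable {X : Type u} [TopologicalSpace X] [PathConnectedSpace X] [LocallyPathConnectedSpace X]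

theorem IsCategoricalUniversalCovering.mem_spanierGroup {E : Type u} [TopologicalSpace E]
    {p : E → X} (h : IsCategoricalUniversalCovering.{u, u} p) {x : X} (e : p ⁻¹' {x})
    {γ : FundamentalGroup X x} (hγ : h.2.1.monodromy γ e = e) : γ ∈ spanierGroup X x := by
  simp only [spanierGroup, Subgroup.mem_iInf]
  intro 𝒰 h𝒰
  obtain ⟨E', _, q, cov, _, hker⟩ := exists_isCoveringMap_of_spanierGroupOfCover_le h𝒰 (x := x)
    (N := spanierGroupOfCover 𝒰 x) le_rfl
  obtain ⟨⟨f, hf, hqf⟩, -⟩ := h.2.2 E' q cov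
  have hqf' : ∀ e, q (f e) = p e := congrFun hqf
  refine (hker ⟨f e, (hqf' e).trans e.2⟩ γ).mp (Subtype.ext ?_)
  rw [h.2.1.monodromy_comp cov hf.continuous hqf', hγ]

theorem countable_of_hasCategoricalUniversalCovering [SecondCountableTopology X]
    (h : HasCategoricalUniversalCovering.{u, u} X) (x : X) :
    Countable (FundamentalGroup X x ⧸ spanierGroup X x) := by
  obtain ⟨E, _, p, hp⟩ := h
  have := hp.1
  obtain ⟨e, he⟩ := hp.2.1.surjective_of_nonempty x
  exact hp.2.1.countable_quotient ⟨e, he⟩ fun γ hγ ↦ hp.mem_spanierGroup _ hγ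

end Converse

/-! ### A criterion for universality -/

section Universal

theorem IsCoveringMap.mem_range_mapOfEq {X : Type*} [TopologicalSpace X] {Y : Type*}
    [TopologicalSpace Y] {q : Y → X} (hq : IsCoveringMap q) {x : X} {y : Y} (hy : q y = x)
    {γ : FundamentalGroup X x} (hγ : hq.monodromy γ ⟨y, hy⟩ = ⟨y, hy⟩) :
    γ ∈ (FundamentalGroup.mapOfEq ⟨q, hq.continuous⟩ hy).range := by
  refine ⟨(hq.liftPathQuotient γ ⟨y, hy⟩).cast rfl congr(($hγ.symm).1), ?_⟩
  rw [FundamentalGroup.mapOfEq_apply, Path.Homotopic.Quotient.map_cast,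
    IsCoveringMap.map_liftPathQuotient, Path.Homotopic.Quotient.cast_cast]
  subst hy
  exact (Path.Homotopic.Quotient.cast_cast ..).trans (Path.Homotopic.Quotient.cast_rfl_rfl γ)

variable {X : Type u} [TopologicalSpace X] [LocallyPathConnectedSpace X]
  {E : Type u} [TopologicalSpace E] [PathConnectedSpace E] {Y : Type v} [TopologicalSpace Y]

/-- Loops in the image of `p` fix `e`, so they lie in the Spanier group, act trivially on the fibre
of `q` and lift to loops at `y`. -/
theorem IsCoveringMap.exists_lift_of_mem_spanierGroup {p : E → X} (hp : IsCoveringMap p) {q : Y → X}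
    (hq : IsCoveringMap q) {x : X} {e : E} (he : p e = x) {y : Y} (hy : q y = x)
    (hker : ∀ γ : FundamentalGroup X x, hp.monodromy γ ⟨e, he⟩ = ⟨e, he⟩ → γ ∈ spanierGroup X x) :
    ∃ f : E → Y, Continuous f ∧ f e = y ∧ q ∘ f = p := by
  subst he
  have := hp.isLocalHomeomorph.locallyPathConnectedSpace
  obtain ⟨𝒰, h𝒰, hle⟩ := hq.exists_isOpenCovering_le_ker_monodromyPerm
  obtain ⟨f, ⟨hfe, hqf⟩, -⟩ := hq.existsUnique_continuousMap_lifts_of_range_le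
    (f := ⟨p, hp.continuous⟩) (a₀ := e) (e₀ := y) hy (by
      rintro _ ⟨g, rfl⟩
      refine hq.mem_range_mapOfEq hy ?_
      have hmem := hle _ (spanierGroup_le h𝒰 _ (hker _ (hp.monodromy_map g)))
      exact congr($(MonoidHom.mem_ker.mp hmem) ⟨y, hy⟩))
  exact ⟨f, f.continuous, hfe, hqf⟩

theorem IsCoveringMap.isCategoricalUniversalCovering [PathConnectedSpace X] {p : E → X}
    (hp : IsCoveringMap p) {x : X}
    (hker : ∀ (e : p ⁻¹' {x}) (γ : FundamentalGroup X x),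
      hp.monodromy γ e = e → γ ∈ spanierGroup X x) :
    IsCategoricalUniversalCovering.{u, v} p := by
  refine ⟨inferInstance, hp, fun Y _ _ q hq ↦ ⟨?_, ?_⟩⟩
  · obtain ⟨e, he⟩ := hp.surjective_of_nonempty x
    obtain ⟨y, hy⟩ := hq.surjective_of_nonempty x
    obtain ⟨f, hf, -, hqf⟩ := hp.exists_lift_of_mem_spanierGroup hq he hy (hker ⟨e, he⟩)
    exact ⟨f, hp.of_comp hq hf hqf, hqf⟩
  · intro f f' hf hf' hqf hqf'
    obtain ⟨e, he⟩ := hp.surjective_of_nonempty x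
    -- The deck transformation of `p` taking `e'` to `e` is the required homeomorphism: after it,
    -- `f` agrees with `f'` at `e'`, hence everywhere.
    obtain ⟨e', he'⟩ := hf'.surjective_of_nonempty (f e)
    have hpe' : p e' = x := by
      rw [← he, ← congrFun hqf' e', ← congrFun hqf e, Function.comp, Function.comp, he']
    obtain ⟨g, hg, hge, hpg⟩ := hp.exists_lift_of_mem_spanierGroup hp hpe' he (hker ⟨e', hpe'⟩)
    obtain ⟨k, hk, hke, hpk⟩ := hp.exists_lift_of_mem_spanierGroup hp he hpe' (hker ⟨e, he⟩)
    have hkg : k ∘ g = id := hp.eq_of_comp_eq (hk.comp hg) continuous_id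
      (by rw [← Function.comp_assoc, hpk, hpg, Function.comp_id]) e' (by simp [hge, hke])
    have hgk : g ∘ k = id := hp.eq_of_comp_eq (hg.comp hk) continuous_id
      (by rw [← Function.comp_assoc, hpg, hpk, Function.comp_id]) e (by simp [hge, hke])
    refine ⟨⟨⟨g, k, congrFun hkg, congrFun hgk⟩, hg, hk⟩, ?_⟩
    refine hq.eq_of_comp_eq (hf.continuous.comp hg) hf'.continuous ?_ e' ?_
    · rw [hqf']
      change (q ∘ f) ∘ g = p
      rw [hqf, hpg]
    · simp [hge, he']

theorem hasCategoricalUniversalCovering_of_le [PathConnectedSpace X] {x : X} {𝒰 : Set (Set X)}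
    (h𝒰 : IsOpenCovering 𝒰) (hle : spanierGroupOfCover 𝒰 x ≤ spanierGroup X x) :
    HasCategoricalUniversalCovering.{u, v} X := by
  obtain ⟨E, _, p, hp, _, hker⟩ := exists_isCoveringMap_of_spanierGroupOfCover_le h𝒰 hle
  exact ⟨E, _, p, hp.isCategoricalUniversalCovering fun e γ ↦ (hker e γ).mp⟩

end Universal

/-! ### Infinite concatenation of shrinking loops -/

section InfiniteConcatenation

variable {X : Type*} [TopologicalSpace X] {y : X}

/-- The concatenation of the `k` loops `b n, …, b (n + k - 1)` and a constant loop. -/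
noncomputable def Path.finiteConcat (b : ℕ → Path y y) : ℕ → ℕ → Path y y
  | 0, _ => Path.refl y
  | k + 1, n => (b n).trans (Path.finiteConcat b k (n + 1))

/-- The two loops differ only on the final interval of length `(1 / 2) ^ k`, where the shorter one
is constant. -/
theorem Path.finiteConcat_succ_apply (b : ℕ → Path y y) (k n : ℕ) (t : unitInterval)
    (ht : (t : ℝ) ≤ 1 - (1 / 2) ^ k) :
    Path.finiteConcat b (k + 1) n t = Path.finiteConcat b k n t := by
  induction k generalizing n t with
  | zero =>
    obtain rfl : t = 0 := Subtype.ext (le_antisymm (by simpa using ht) t.2.1)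
    simp
  | succ k ih =>
    change ((b n).trans (Path.finiteConcat b (k + 1) (n + 1))) t =
      ((b n).trans (Path.finiteConcat b k (n + 1))) t
    rw [Path.trans_apply, Path.trans_apply]
    split_ifs with h
    · rfl
    · refine ih _ _ ?_
      rw [pow_succ] at ht
      simp only
      linarith

theorem Path.finiteConcat_apply_of_le (b : ℕ → Path y y) {k m : ℕ} (hkm : k ≤ m) (n : ℕ)
    (t : unitInterval) (ht : (t : ℝ) ≤ 1 - (1 / 2) ^ k) :
    Path.finiteConcat b m n t = Path.finiteConcat b k n t := by
  induction m, hkm using Nat.le_induction with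
  | base => rfl
  | succ m hm ih =>
    rw [Path.finiteConcat_succ_apply b m n t (ht.trans ?_), ih]
    have : (1 / 2 : ℝ) ^ m ≤ (1 / 2) ^ k := pow_le_pow_of_le_one (by norm_num) (by norm_num) hm
    linarith

theorem Path.finiteConcat_mem {U : ℕ → Set X} (hU : Antitone U) {b : ℕ → Path y y}
    (hb : ∀ n, range (b n) ⊆ U n) (k n : ℕ) (t : unitInterval) :
    Path.finiteConcat b k n t ∈ U n := by
  induction k generalizing n t with
  | zero => exact hb n ⟨0, (b n).source⟩
  | succ k ih =>
    rw [Path.finiteConcat, Path.trans_apply]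
    split_ifs with h
    · exact hb n ⟨_, rfl⟩
    · exact hU n.le_succ (ih _ _)

/-- A sequence of loops that shrinks to the base point can be concatenated. -/
theorem Path.exists_infinite_trans {U : ℕ → Set X} (hU : Antitone U)
    (hbasis : ∀ W ∈ 𝓝 y, ∃ n, U n ⊆ W) {b : ℕ → Path y y} (hb : ∀ n, range (b n) ⊆ U n) :
    ∃ T : ℕ → Path y y, (∀ n, range (T n) ⊆ U n) ∧ ∀ n, T n = (b n).trans (T (n + 1)) := by
  have hlt : ∀ t : unitInterval, t ≠ 1 → ∃ k : ℕ, (t : ℝ) < 1 - (1 / 2) ^ k := fun t ht ↦ by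
    have h1 : (t : ℝ) < 1 := lt_of_le_of_ne t.2.2 fun h ↦ ht (Subtype.ext h)
    obtain ⟨k, hk⟩ := exists_pow_lt_of_lt_one (sub_pos.mpr h1) (by norm_num : (1 / 2 : ℝ) < 1)
    exact ⟨k, by linarith⟩
  choose K hK using hlt
  classical
  let T (n : ℕ) (t : unitInterval) : X :=
    if ht : t = 1 then y else Path.finiteConcat b (K t ht) n t
  have hT1 : ∀ n, T n 1 = y := fun n ↦ by simp [T]
  have hT : ∀ n k (t : unitInterval), (t : ℝ) ≤ 1 - (1 / 2) ^ k →
      T n t = Path.finiteConcat b k n t := fun n k t ht ↦ by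
    have ht1 : t ≠ 1 := by
      rintro rfl
      have : (0 : ℝ) < (1 / 2) ^ k := by positivity
      rw [Set.Icc.coe_one] at ht
      linarith
    simp only [T, dif_neg ht1]
    rcases le_total k (K t ht1) with h | h
    · exact Path.finiteConcat_apply_of_le b h n t ht
    · exact (Path.finiteConcat_apply_of_le b h n t (hK t ht1).le).symm
  have hTmem : ∀ n t, T n t ∈ U n := fun n t ↦ by
    by_cases ht : t = 1
    · rw [ht, hT1]; exact hb n ⟨0, (b n).source⟩
    · rw [hT n _ t (hK t ht).le]; exact Path.finiteConcat_mem hU hb _ _ _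
  have hleft : ∀ n (t : unitInterval) (ht : (t : ℝ) ≤ 1 / 2),
      T n t = b n ⟨2 * t, (unitInterval.mul_pos_mem_iff zero_lt_two).2 ⟨t.2.1, ht⟩⟩ :=
    fun n t ht ↦ by
      rw [hT n 1 t (by linarith), Path.finiteConcat, Path.trans_apply, dif_pos ht]
  have hright : ∀ n (t : unitInterval) (ht : ¬ (t : ℝ) ≤ 1 / 2),
      T n t = T (n + 1) ⟨2 * t - 1, unitInterval.two_mul_sub_one_mem_iff.2
        ⟨(not_le.mp ht).le, t.2.2⟩⟩ := fun n t ht ↦ by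
    by_cases h1 : t = 1
    · subst h1
      rw [hT1]
      convert (hT1 (n + 1)).symm
      norm_num
    · have hk := hK t h1
      -- Stage `K + 1` from `n` unfolds to `b n` followed by stage `K` from `n + 1`.
      have hk' : (t : ℝ) ≤ 1 - (1 / 2) ^ (K t h1 + 1) := by
        have : (1 / 2 : ℝ) ^ (K t h1 + 1) ≤ (1 / 2) ^ (K t h1) :=
          pow_le_pow_of_le_one (by norm_num) (by norm_num) (Nat.le_succ _)
        linarith
      rw [hT n _ t hk', hT (n + 1) (K t h1), Path.finiteConcat, Path.trans_apply, dif_neg ht]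
      rw [pow_succ] at hk'
      simp only
      linarith
  -- This gives continuity at 1: the tails stay in ever smaller `U (n + k)`.
  have htail : ∀ k n (t : unitInterval), 1 - (1 / 2 : ℝ) ^ k < t → T n t ∈ U (n + k) := by
    intro k
    induction k with
    | zero => exact fun n t _ ↦ hTmem n t
    | succ k ih =>
      intro n t ht
      have hk : (1 / 2 : ℝ) ^ k ≤ 1 := pow_le_one₀ (by norm_num) (by norm_num)
      rw [pow_succ] at ht
      rw [hright n t (by linarith), Nat.add_comm k 1, ← Nat.add_assoc]
      refine ih _ _ ?_
      simp only
      linarith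
  have hcont : ∀ n, Continuous (T n) := fun n ↦ by
    refine continuous_iff_continuousAt.mpr fun t ↦ ?_
    by_cases ht : t = 1
    · subst ht
      intro W hW
      rw [hT1] at hW
      obtain ⟨N, hN⟩ := hbasis W hW
      have hnhds : {t : unitInterval | 1 - (1 / 2 : ℝ) ^ N < t} ∈ 𝓝 (1 : unitInterval) :=
        (isOpen_lt continuous_const continuous_subtype_val).mem_nhds (by simp)
      exact Filter.mem_map.mpr (Filter.mem_of_superset hnhds fun t ht ↦
        hN (hU (Nat.le_add_left N n) (htail N n t ht)))
    · have hnhds : {s : unitInterval | (s : ℝ) < 1 - (1 / 2) ^ (K t ht)} ∈ 𝓝 t :=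
        (isOpen_lt continuous_subtype_val continuous_const).mem_nhds (hK t ht)
      refine (Path.finiteConcat b (K t ht) n).continuous.continuousAt.congr ?_
      filter_upwards [hnhds] with s hs
      exact (hT n _ s (le_of_lt hs)).symm
  refine ⟨fun n ↦ ⟨⟨T n, hcont n⟩, ?_, hT1 n⟩, ?_, fun n ↦ ?_⟩
  · rw [ContinuousMap.toFun_eq_coe, ContinuousMap.coe_mk, hT n 0 0 (by simp)]
    exact Path.source _
  · rintro n _ ⟨t, rfl⟩
    exact hTmem n t
  · ext t
    rw [Path.trans_apply]
    split_ifs with h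
    · exact hleft n t h
    · exact hright n t h

end InfiniteConcatenation

/-! ### Countability makes small loops trivial -/

section Countable

variable {X : Type*} [TopologicalSpace X]

/-- If the holonomy modulo `S` takes only countably many values and the values outside of `S` are
detected by subgroups that contain the holonomy of all small loops at `y`, then the holonomy of
all small loops at `y` lies in `S`. -/
theorem Holonomy.exists_nhds_hol_mem [FirstCountableTopology X] {Q : Type*} [Group Q]
    (h : Holonomy X Q) (S : Subgroup Q) [S.Normal] [Countable (Q ⧸ S)] (y : X)
    (hS : ∀ g ∉ S, ∃ N : Subgroup Q, S ≤ N ∧ g ∉ N ∧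
      ∃ W ∈ 𝓝 y, ∀ β : Path y y, range β ⊆ W → h.hol β ∈ N) :
    ∃ U ∈ 𝓝 y, ∀ β : Path y y, range β ⊆ U → h.hol β ∈ S := by
  by_contra! hcon
  choose β hβU hβS using fun U : {U // U ∈ 𝓝 y} ↦ hcon U.1 U.2
  choose N hSN hβN W hW hWN using fun U ↦ hS _ (hβS U)
  obtain ⟨B, hB⟩ := (𝓝 y).exists_antitone_basis
  -- Intersecting with `W U` puts the holonomy of all later loops into `N U`, which misses that of
  -- `β U`; intersecting with `B (n + 1)` makes the sequence a basis.
  let u : ℕ → {U // U ∈ 𝓝 y} := fun n ↦ Nat.rec ⟨B 0, hB.1.mem_of_mem trivial⟩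
    (fun n U ↦ ⟨U.1 ∩ B (n + 1) ∩ W U,
      Filter.inter_mem (Filter.inter_mem U.2 (hB.1.mem_of_mem trivial)) (hW U)⟩) n
  have hu : ∀ n, (u (n + 1)).1 = (u n).1 ∩ B (n + 1) ∩ W (u n) := fun n ↦ rfl
  have hanti : Antitone fun n ↦ (u n).1 := antitone_nat_of_succ_le fun n ↦ by
    rw [hu]; exact inter_subset_left.trans inter_subset_left
  have huB : ∀ n, (u n).1 ⊆ B n := fun n ↦ by
    cases n with
    | zero => exact subset_rfl
    | succ n => rw [hu]; exact inter_subset_left.trans inter_subset_right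
  have hbasis : ∀ V ∈ 𝓝 y, ∃ n, (u n).1 ⊆ V := fun V hV ↦ by
    obtain ⟨n, -, hn⟩ := hB.1.mem_iff.mp hV
    exact ⟨n, (huB n).trans hn⟩
  classical
  let b (A : Set ℕ) (n : ℕ) : Path y y := if n ∈ A then β (u n) else Path.refl y
  have hb : ∀ A n, range (b A n) ⊆ (u n).1 := fun A n ↦ by
    by_cases hn : n ∈ A
    · simpa only [b, if_pos hn] using hβU (u n)
    · simpa only [b, if_neg hn, Path.refl_range, singleton_subset_iff] using mem_of_mem_nhds (u n).2
  choose T hTu hT using fun A ↦ Path.exists_infinite_trans hanti hbasis (hb A)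
  have hTN : ∀ A n, h.hol (T A (n + 1)) ∈ N (u n) := fun A n ↦
    hWN (u n) _ ((hTu A (n + 1)).trans (by rw [hu]; exact inter_subset_right))
  have hol_T : ∀ A n, h.hol (T A n) = h.hol (T A (n + 1)) * h.hol (b A n) := fun A n ↦ by
    conv_lhs => rw [hT A n]
    exact h.hol_trans _ _
  -- Modulo `N (u n)` the tails vanish, so if `n` were in `A` but not in `A'`, the holonomy of `β (u
  -- n)` would lie in `N (u n)`.
  have hhead : ∀ A A' n, (h.hol (T A n))⁻¹ * h.hol (T A' n) ∈ S → n ∈ A → n ∈ A' := by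
    intro A A' n hmem hA
    by_contra hA'
    have hmem' := hSN (u n) hmem
    rw [hol_T A n, hol_T A' n] at hmem'
    simp only [b, if_pos hA, if_neg hA', h.hol_refl, mul_one, mul_inv_rev] at hmem'
    rw [Subgroup.mul_mem_cancel_right _ (hTN A' n),
      Subgroup.mul_mem_cancel_right _ (inv_mem (hTN A n)), inv_mem_iff] at hmem'
    exact hβN _ hmem'
  have hsymm : ∀ A A' n, (h.hol (T A n))⁻¹ * h.hol (T A' n) ∈ S →
      (h.hol (T A' n))⁻¹ * h.hol (T A n) ∈ S := fun A A' n hmem ↦ by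
    simpa using inv_mem hmem
  -- Once `A` and `A'` agree at `n`, the common first loop is removed by conjugation, using
  -- normality of `S`.
  have hnext : ∀ A A', (h.hol (T A 0))⁻¹ * h.hol (T A' 0) ∈ S →
      ∀ n, (h.hol (T A n))⁻¹ * h.hol (T A' n) ∈ S := by
    intro A A' h0 n
    induction n with
    | zero => exact h0
    | succ n ih =>
      have hbn : b A n = b A' n := by
        have : n ∈ A ↔ n ∈ A' := ⟨hhead A A' n ih, hhead A' A n (hsymm A A' n ih)⟩
        simp only [b, this]
      rw [hol_T A n, hol_T A' n, hbn] at ih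
      have := Subgroup.Normal.conj_mem ‹S.Normal› _ ih (h.hol (b A' n))
      simpa [mul_assoc] using this
  have hinj : Function.Injective fun A : Set ℕ ↦ (QuotientGroup.mk (h.hol (T A 0)) : Q ⧸ S) := by
    intro A A' hAA'
    have hmem := hnext A A' (QuotientGroup.eq.mp hAA')
    exact Set.ext fun n ↦ ⟨hhead A A' n (hmem n), hhead A' A n (hsymm A A' n (hmem n))⟩
  obtain ⟨f, hf⟩ := exists_injective_nat (Q ⧸ S)
  exact Function.cantor_injective _ (hf.comp hinj)

end Countable

/-! ### A cover realizing the Spanier group -/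

section Existence

variable {X : Type u} [TopologicalSpace X] [PathConnectedSpace X] [LocallyPathConnectedSpace X]

theorem exists_spanierGroupOfCover_le [FirstCountableTopology X] (x : X)
    [Countable (FundamentalGroup X x ⧸ spanierGroup X x)] :
    ∃ 𝒰 : Set (Set X), IsOpenCovering 𝒰 ∧ spanierGroupOfCover 𝒰 x ≤ spanierGroup X x := by
  have hsmall : ∀ y, ∃ U ∈ 𝓝 y, ∀ β : Path y y, range β ⊆ U →
      (pathHolonomy x).hol β ∈ spanierGroup X x := fun y ↦ by
    refine (pathHolonomy x).exists_nhds_hol_mem (spanierGroup X x) y fun g hg ↦ ?_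
    simp only [spanierGroup, Subgroup.mem_iInf, not_forall] at hg
    obtain ⟨𝒱, h𝒱, hg⟩ := hg
    obtain ⟨W, hW, hy⟩ := mem_sUnion.mp (h𝒱.2 ▸ mem_univ y)
    refine ⟨_, spanierGroup_le h𝒱 x, hg, W, (h𝒱.1 W hW).mem_nhds hy, fun β hβ ↦ ?_⟩
    rw [pathHolonomy_loop_mem_iff _ (PathConnectedSpace.somePath x y)]
    exact Subgroup.subset_closure ⟨y, _, β, ⟨W, hW, hβ⟩, rfl⟩
  have hopen : ∀ y, ∃ V, (IsOpen V ∧ y ∈ V ∧ IsPathConnected V) ∧ ∀ β : Path y y, range β ⊆ V →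
      (pathHolonomy x).hol β ∈ spanierGroup X x := fun y ↦ by
    obtain ⟨U, hU, hUβ⟩ := hsmall y
    obtain ⟨V, hV, hVU⟩ := (isOpen_isPathConnected_basis y).mem_iff.mp hU
    exact ⟨V, hV, fun β hβ ↦ hUβ β (hβ.trans hVU)⟩
  choose V hV hVβ using hopen
  refine ⟨range V, ⟨?_, ?_⟩, (Subgroup.closure_le _).mpr ?_⟩
  · rintro _ ⟨y, rfl⟩
    exact (hV y).1
  · exact eq_univ_of_forall fun y ↦ ⟨V y, ⟨y, rfl⟩, (hV y).2.1⟩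
  · rintro _ ⟨z, α, β, ⟨_, ⟨y, rfl⟩, hβ⟩, rfl⟩
    refine (pathHolonomy_loop_mem_iff (spanierGroup X x) α β).mp ?_
    -- `β` is based at `z`, while smallness is known only for loops at `y`; conjugating by `δ`
    -- inside `V y` moves the base point.
    obtain ⟨δ, hδ⟩ := (hV y).2.2.joinedIn y (hV y).2.1 z (hβ ⟨0, β.source⟩)
    have hδ' : range δ ⊆ V y := by rintro _ ⟨t, rfl⟩; exact hδ t
    rw [← (pathHolonomy x).hol_conj_mem_iff (spanierGroup X x) δ]
    refine hVβ y _ ?_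
    rw [Path.trans_range, Path.trans_range, Path.symm_range]
    exact union_subset (union_subset hδ' hβ) hδ'

end Existence

theorem theorem2 :
    (∀ (X : Type u) [TopologicalSpace X] [ConnectedSpace X] [LocallyPathConnectedSpace X]
      [FirstCountableTopology X] (x : X),
      Countable (FundamentalGroup X x ⧸ spanierGroup X x) →
        HasCategoricalUniversalCovering.{u, v} X) ∧
    (∀ (X : Type u) [TopologicalSpace X] [ConnectedSpace X] [LocallyPathConnectedSpace X]
      [TopologicalSpace.MetrizableSpace X] [TopologicalSpace.SeparableSpace X] (x : X),
      HasCategoricalUniversalCovering.{u, u} X →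
        Countable (FundamentalGroup X x ⧸ spanierGroup X x)) := by
  refine ⟨fun X _ _ _ _ x _ ↦ ?_, fun X _ _ _ _ _ x h ↦ ?_⟩
  · have : PathConnectedSpace X := .of_locallyPathConnectedSpace
    obtain ⟨𝒰, h𝒰, hle⟩ := exists_spanierGroupOfCover_le x
    exact hasCategoricalUniversalCovering_of_le h𝒰 hle
  · have : PathConnectedSpace X := .of_locallyPathConnectedSpace
    let _ := TopologicalSpace.metrizableSpaceMetric X
    have : SecondCountableTopology X := UniformSpace.secondCountable_of_separable X
    exact countable_of_hasCategoricalUniversalCovering h x
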